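/- Let $n \ge 1$ and let $\mathcal O_{amb} = \mathbb Z[a_{ij}, z_j]$ be the polynomial ring in the variables $a_{ij}$, $z_j$ with $1 \le i \le n$, $1 \le j \le n+1$. For $1\le i\le n$ let $f_i(T_1,\dots,T_{n+1}) = \sum_{j=1}^{n+1} a_{ij}T_j$ and $f_i = f_i(z_1,\dots,z_{n+1})$. Let $\mathcal O_X = \mathcal O_{amb}/(f_1,\dots,f_n)$ and let $I_D = (z_1,\dots,z_{n+1}) \subset \mathcal O_X$. Let $I_r = \{ h(z_1) : h \in \operatorname{Hom}_{\mathcal O_X}(I_D,\mathcal O_X)\}$ be the residual ideal of $I_D$ with respect to $z_1$. The ring $\mathcal O_X$ is an integral domain; let $K(X)$ be its quotient field, put $I_r^{-1} = \{x \in K(X) : x I_r \subset \mathcal O_X\}$, and let the generic type III unprojection ring $\mathcal O_X[I_r^{-1}]$ be the $\mathcal O_X$-subalgebra of $K(X)$ generated by $I_r^{-1}$. Let $\varphi : \mathcal O_{amb}[T_2,\dots,T_{n+1}] \to K(X)$ be the ring homomorphism which on $\mathcal O_{amb}$ is the natural projection to $\mathcal O_X \subset K(X)$ and which sends $T_i$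 to $z_i/z_1$ for $2 \le i \le n+1$. Then $$\ker \varphi = \bigl(z_i - z_1T_i,\ f_j(1,T_2,\dots,T_{n+1}) \;:\; 2 \le i \le n+1,\ 1 \le j \le n\bigr),$$ and the image of $\varphi$ is $\mathcal O_X[I_r^{-1}]$. Consequently $\mathcal O_X[I_r^{-1}]$ is isomorphic, as a ring, to a polynomial ring over $\mathbb Z$ (in $n^2+n+1$ variables), and hence it is Gorenstein (that is, Noetherian, and each localization at a prime ideal has finite injective dimension over itself). -/

import Mathlib

universe u

/-- A commutative ring is Gorenstein if it is Noetherian and each of its localizations at a prime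
ideal is a Gorenstein local ring, that is, has finite injective dimension as a module over
itself. -/
class IsGorensteinRing (R : Type u) [CommRing R] : Prop where
  isNoetherianRing : IsNoetherianRing R
  exists_hasInjectiveDimensionLE : ∀ (p : Ideal R) [p.IsPrime], ∃ d : ℕ,
    CategoryTheory.HasInjectiveDimensionLE
      (ModuleCat.of (Localization.AtPrime p) (Localization.AtPrime p)) d

/-- The residual ideal `{f(z) : f ∈ Hom_R(I, R)}` of an ideal `I` with respect to an
element `z ∈ I`. -/
def residualIdeal {R : Type*} [CommRing R] (I : Ideal R) (z : I) : Ideal R :=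
  LinearMap.range (LinearMap.applyₗ z : (I →ₗ[R] R) →ₗ[R] R)

/-- For an ideal `I` of `R` and a field `K` over `R` (the quotient field of `R` in practice),
the set `I⁻¹ = {x ∈ K : x I ⊆ R}`. -/
def inverseSet {R : Type*} [CommRing R] (K : Type*) [Field K] [Algebra R K] (I : Ideal R) :
    Set K :=
  {x | ∀ r ∈ I, x * algebraMap R K r ∈ Set.range (algebraMap R K)}

namespace TypeIII

open MvPolynomial

/-- The polynomial ring `ℤ[a_ij, z_j]`, `1 ≤ i ≤ n`, `1 ≤ j ≤ n + 1`. Indices start at `0` in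
the code, so the variables `z₁, …, z_{n+1}` are `z 0, …, z n`. -/
abbrev Amb (n : ℕ) : Type := MvPolynomial ((Fin n × Fin (n + 1)) ⊕ Fin (n + 1)) ℤ

/-- The variable `a_ij`. -/
noncomputable def a {n : ℕ} (i : Fin n) (j : Fin (n + 1)) : Amb n := X (Sum.inl (i, j))

/-- The variable `z_j`. -/
noncomputable def z {n : ℕ} (j : Fin (n + 1)) : Amb n := X (Sum.inr j)

/-- The generic linear form `f_i(T₁, …, T_{n+1}) = ∑ j, a_ij T_j`, with coefficients in
`ℤ[a_ij, z_j]`. -/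
noncomputable def form {n : ℕ} (i : Fin n) : MvPolynomial (Fin (n + 1)) (Amb n) :=
  ∑ j, C (a i j) * X j

/-- `f_i = f_i(z) = ∑ j, a_ij z_j`. -/
noncomputable def f {n : ℕ} (i : Fin n) : Amb n := ∑ j, a i j * z j

/-- The ideal `I_X = (f₁, …, f_n)`. -/
noncomputable def IX (n : ℕ) : Ideal (Amb n) := Ideal.span (Set.range f)

/-- The coordinate ring `O_X` of the generic complete intersection. -/
abbrev OX (n : ℕ) : Type := Amb n ⧸ IX n

/-- The class of `z_j` in `O_X`. -/
noncomputable def zX {n : ℕ} (j : Fin (n + 1)) : OX n := Ideal.Quotient.mk (IX n) (z j)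

/-- The ideal `I_D = (z₁, …, z_{n+1})` of `O_X`. -/
noncomputable def ID (n : ℕ) : Ideal (OX n) := Ideal.span (Set.range zX)

/-- The residual ideal `I_r` of `I_D` with respect to `z₁`. -/
noncomputable def Ir (n : ℕ) : Ideal (OX n) :=
  residualIdeal (ID n) ⟨zX 0, Ideal.subset_span ⟨0, rfl⟩⟩

/-- The generic type III unprojection ring `O_X[I_r⁻¹]`, for `K` the quotient field of `O_X`. -/
noncomputable def unprojection (n : ℕ) (K : Type*) [Field K] [Algebra (OX n) K] :
    Subalgebra (OX n) K :=
  Algebra.adjoin (OX n) (inverseSet K (Ir n))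

/-- The ring homomorphism `φ : ℤ[a_ij, z_j][T₂, …, T_{n+1}] → K` which is the natural map on
`ℤ[a_ij, z_j]` and sends `T_i` to `z_i / z₁`. The variable `X k`, `k : Fin n`, is `T_{k+2}` (and
`z k.succ` is `z_{k+2}`). -/
noncomputable def φ (n : ℕ) (K : Type*) [Field K] [Algebra (OX n) K] :
    MvPolynomial (Fin n) (Amb n) →+* K :=
  eval₂Hom ((algebraMap (OX n) K).comp (Ideal.Quotient.mk (IX n)))
    (fun k => algebraMap (OX n) K (zX k.succ) / algebraMap (OX n) K (zX 0))

/-- The polynomial `f_j(1, T₂, …, T_{n+1})`. -/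
noncomputable def formOne {n : ℕ} (j : Fin n) : MvPolynomial (Fin n) (Amb n) :=
  aeval (Fin.cons 1 X : Fin (n + 1) → MvPolynomial (Fin n) (Amb n)) (form j)

/-- The ideal `(z_i - z₁ T_i, f_j(1, T₂, …, T_{n+1}))`, `2 ≤ i ≤ n + 1`, `1 ≤ j ≤ n`. -/
noncomputable def relations (n : ℕ) : Ideal (MvPolynomial (Fin n) (Amb n)) :=
  Ideal.span (Set.range (fun k : Fin n => C (z k.succ) - C (z 0) * X k) ∪ Set.range formOne)

end TypeIII

/-! The relations solve for `z_i` (as `z₁ T_i`) and for `a_{i1}`, so they present the polynomial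
ring `Chart n` in `a_ij` (`j ≥ 2`), `z₁` and `T_j`. The map `φ` factors through this ring, and its
kernel is `relations n` once `Chart n → K` is injective.

That follows from injectivity of `O_X → Chart n`, i.e. `ker_toChart`, by a Gröbner-type argument.
Modulo the `f_i`, products `a_{i,i+1} z_{i+1}` can be rewritten away, and the remaining monomials
have images with distinct leading monomials. In particular `O_X` is a domain.

For the image, `z_k h(z₁) = z₁ h(z_k)` puts `z_k / z₁` in `I_r⁻¹`. Conversely, `I_r` contains `z₁`
and, by Cramer's rule, the determinant `δ` of `(a_ij)`, `j ≥ 2`. If `x ∈ I_r⁻¹`, then `(x z₁) δ = (x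
δ) z₁` vanishes modulo `I_D`; as `O_X / I_D = ℤ[a_ij]` is a domain where `δ ≠ 0`, `x z₁ ∈ I_D`.
Hence `x` is an `O_X`-combination of `1` and the `z_k / z₁`.

The Gorenstein property comes from finite global dimension: at most 1 for `ℤ`, at most one more per
variable, and no increase under localization. -/

section GlobalDimension

/-! ### Finite global dimension -/

open CategoryTheory Polynomial TensorProduct

/-- Every module over `R` (in the universe of `R`) has projective dimension at most `d`. -/
def GlobalDimensionLE (R : Type u) [CommRing R] (d : ℕ) : Prop :=
  ∀ M : ModuleCat.{u} R, HasProjectiveDimensionLE M d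

namespace GlobalDimensionLE

variable {R : Type u} [CommRing R] {d : ℕ}

/-- `Ext` into `M` vanishes above `d` because every first argument has projective dimension at most
`d`. -/
theorem hasInjectiveDimensionLE (h : GlobalDimensionLE R d) (M : ModuleCat.{u} R) :
    HasInjectiveDimensionLE M d := by
  let := HasExt.standard (ModuleCat.{u} R)
  refine (hasInjectiveDimensionLT_iff M (d + 1)).2 fun i hi Y e => ?_
  have := h Y
  exact e.eq_zero_of_hasProjectiveDimensionLT (d + 1) hi

attribute [local instance] RingHomInvPair.of_ringEquiv in
theorem of_ringEquiv {S : Type u} [CommRing S] (e : R ≃+* S) (h : GlobalDimensionLE R d) :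
    GlobalDimensionLE S d := by
  intro N
  let M : ModuleCat.{u} R :=
    let := Module.compHom N e.toRingHom
    ModuleCat.of R N
  let e' : M ≃ₛₗ[RingHomClass.toRingHom e] N :=
    { __ := AddEquiv.refl N
      map_smul' r x := rfl }
  have := h M
  exact ModuleCat.hasProjectiveDimensionLE_of_semiLinearEquiv e e' d

/-- A module over the localization is the localization of its restriction to `R`, and localizing
does not raise projective dimension. -/
theorem localization (h : GlobalDimensionLE R d) (S : Submonoid R) :
    GlobalDimensionLE (Localization S) d := by
  intro N
  let M : ModuleCat.{u} R :=
    let := Module.compHom N (algebraMap R (Localization S))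
    ModuleCat.of R N
  let : Module (Localization S) M := inferInstanceAs (Module (Localization S) N)
  have : IsScalarTower R (Localization S) M :=
    ⟨fun r s x => by
      rw [Algebra.smul_def, mul_smul]
      rfl⟩
  have := h M
  have := ModuleCat.localizedModule_hasProjectiveDimensionLE d S M
  have hid : IsLocalizedModule S (LinearMap.id : M →ₗ[R] M) := by
    refine ⟨fun s => ?_, fun y => ⟨(y, 1), by simp⟩, fun {a b} hab => ⟨1, by simpa using hab⟩⟩
    have := IsLocalization.map_units (Localization S) s
    have h1 := this.map (Module.toModuleEnd R (S := Localization S) M)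
    convert h1 using 1
    ext x
    exact (IsScalarTower.algebraMap_smul (Localization S) (s : R) x).symm
  let e : M.localizedModule S ≃ₗ[R] M := IsLocalizedModule.linearEquiv S
    (M.localizedModuleMkLinearMap S) LinearMap.id
  let e' := LinearEquiv.extendScalarsOfIsLocalization S (Localization S) e
  exact ModuleCat.hasProjectiveDimensionLE_of_linearEquiv (N := N) e' d

end GlobalDimensionLE

/-- Over a principal ideal domain, quotients of injective modules are injective. -/
theorem Module.Baer.quotient_of_isPrincipalIdealRing {R : Type u} [CommRing R] [IsDomain R]
    [IsPrincipalIdealRing R] {I Q : Type u} [AddCommGroup I] [Module R I] [AddCommGroup Q]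
    [Module R Q] (hI : Module.Baer R I) (p : I →ₗ[R] Q) (hp : Function.Surjective p) :
    Module.Baer R Q := by
  intro J g
  obtain ⟨r, rfl⟩ := (IsPrincipalIdealRing.principal J).principal
  have hr : r ∈ Submodule.span R {r} := Submodule.mem_span_singleton_self r
  -- Extending `g` from `(r)` to `R` amounts to choosing the image `y` of `1`.
  suffices h : ∃ y : Q, r • y = g ⟨r, hr⟩ by
    obtain ⟨y, hy⟩ := h
    refine ⟨LinearMap.toSpanSingleton R Q y, fun x hx => ?_⟩
    obtain ⟨s, rfl⟩ := Submodule.mem_span_singleton.1 hx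
    rw [LinearMap.toSpanSingleton_apply, smul_assoc, hy, ← map_smul]
    rfl
  obtain ⟨x, hx⟩ := hp (g ⟨r, hr⟩)
  by_cases h0 : r = 0
  · refine ⟨0, ?_⟩
    have : (⟨r, hr⟩ : Submodule.span R {r}) = 0 := Subtype.ext h0
    rw [this, map_zero, smul_zero]
  · obtain ⟨k, hk⟩ := hI (Submodule.span R {r})
      ((LinearMap.toSpanSingleton R I x).comp
        (LinearEquiv.toSpanNonzeroSingleton R R r h0).symm.toLinearMap)
    refine ⟨p (k 1), ?_⟩
    rw [← map_smul, ← map_smul, smul_eq_mul, mul_one, hk r hr, ← hx]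
    have : (LinearEquiv.toSpanNonzeroSingleton R R r h0).symm ⟨r, hr⟩ = 1 := by
      rw [LinearEquiv.symm_apply_eq]
      ext
      simp
    simp [this]

/-- Embed `M` in an injective: the cokernel is again injective, so `Ext` into `M` vanishes from
degree 2 on. -/
theorem GlobalDimensionLE.of_isPrincipalIdealRing (R : Type u) [CommRing R] [IsDomain R]
    [IsPrincipalIdealRing R] : GlobalDimensionLE R 1 := by
  intro X
  let := HasExt.standard (ModuleCat.{u} R)
  refine (hasProjectiveDimensionLT_iff X 2).2 fun i hi M e => ?_
  let ⟨p⟩ := EnoughInjectives.presentation M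
  have hS : (ShortComplex.mk _ _ (Limits.cokernel.condition p.f)).ShortExact :=
    { exact := ShortComplex.exact_cokernel p.f }
  have h3 : Injective (Limits.cokernel p.f) := by
    have hI : Module.Injective R p.J :=
      Module.injective_module_of_injective_object R p.J (inj := p.injective)
    refine Module.injective_object_of_injective_module R _ (inj := ?_)
    exact (Module.Baer.quotient_of_isPrincipalIdealRing (Module.Baer.of_injective hI)
      (Limits.cokernel.π p.f).hom ((ModuleCat.epi_iff_surjective _).1 inferInstance)).injective
  have := (hS.hasInjectiveDimensionLT_X₃_iff 0 p.injective).1 inferInstance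
  exact e.eq_zero_of_hasInjectiveDimensionLT 2 hi


/-! ### Global dimension of polynomial rings -/

section Polynomial

variable {R : Type u} [CommRing R]

/-- Dimension shifting: flat base change keeps a projective presentation exact and its middle term
projective. -/
theorem ModuleCat.hasProjectiveDimensionLE_baseChange (S : Type u) [CommRing S] [Algebra R S]
    [Module.Flat R S] (d : ℕ) (M : ModuleCat.{u} R) [HasProjectiveDimensionLE M d] :
    HasProjectiveDimensionLE (ModuleCat.of S (S ⊗[R] M)) d := by
  induction d generalizing M with
  | zero =>
    have h : Projective M := (projective_iff_hasProjectiveDimensionLE_zero M).2 ‹_›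
    have : Module.Projective R M := M.projective_of_module_projective
    exact (projective_iff_hasProjectiveDimensionLE_zero _).1 inferInstance
  | succ d ih =>
    have hT := M.shortExact_projectiveShortComplex
    set T := M.projectiveShortComplex
    have hP : Projective T.X₂ := inferInstanceAs (Projective M.projectiveShortComplex.X₂)
    have := (hT.hasProjectiveDimensionLT_X₃_iff d hP).1 ‹_›
    have := ih T.X₁
    have : Module.Projective R T.X₂ := T.X₂.projective_of_module_projective
    have hex : Function.Exact T.f.hom T.g.hom :=
      (ShortComplex.ShortExact.moduleCat_exact_iff_function_exact T).1 hT.exact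
    have hex' : Function.Exact (T.f.hom.baseChange S) (T.g.hom.baseChange S) :=
      Module.Flat.lTensor_exact S hex
    have hT' := ModuleCat.shortComplex_shortExact
      (ModuleCat.shortComplexOfCompEqZero (T.f.hom.baseChange S) (T.g.hom.baseChange S)
        hex'.linearMap_comp_eq_zero) hex'
      (Module.Flat.lTensor_preserves_injective_linearMap (M := S) T.f.hom
        hT.moduleCat_injective_f)
      (LinearMap.lTensor_surjective S hT.moduleCat_surjective_g)
    refine (hT'.hasProjectiveDimensionLT_X₃_iff d ?_).2 (ih T.X₁)
    exact inferInstanceAs (Projective (ModuleCat.of S (S ⊗[R] T.X₂)))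

namespace Polynomial

variable (R) (M : Type u) [AddCommGroup M] [Module R M] [Module R[X] M] [IsScalarTower R R[X] M]

/-- Multiplication by `X` on a module over `R[X]`, as an `R`-linear map. -/
noncomputable def mulX : M →ₗ[R] M := (LinearMap.lsmul R[X] M X).restrictScalars R

@[simp]
theorem mulX_apply (m : M) : mulX R M m = (X : R[X]) • m := rfl

/-- The action map `R[X] ⊗ M → M` of a module over `R[X]`. -/
noncomputable def tensorAct : R[X] ⊗[R] M →ₗ[R[X]] M :=
  LinearMap.liftBaseChange R[X] LinearMap.id

@[simp]
theorem tensorAct_tmul (p : R[X]) (m : M) : tensorAct R M (p ⊗ₜ m) = p • m := by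
  simp [tensorAct]

/-- The map `X ⊗ 1 - 1 ⊗ X` on `R[X] ⊗ M`, for a module `M` over `R[X]`. -/
noncomputable def tensorSub : R[X] ⊗[R] M →ₗ[R[X]] R[X] ⊗[R] M :=
  LinearMap.liftBaseChange R[X]
    (TensorProduct.mk R R[X] M X - TensorProduct.mk R R[X] M 1 ∘ₗ mulX R M)

@[simp]
theorem tensorSub_tmul (p : R[X]) (m : M) :
    tensorSub R M (p ⊗ₜ m) = (p * X) ⊗ₜ m - p ⊗ₜ ((X : R[X]) • m) := by
  simp [tensorSub, smul_sub, TensorProduct.smul_tmul']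

/-- The maps `m ↦ ∑ i < k, X ^ i ⊗ X ^ (k - 1 - i) m`. -/
noncomputable def homotopyAux : ℕ → M →ₗ[R] R[X] ⊗[R] M
  | 0 => 0
  | k + 1 => TensorProduct.mk R R[X] M (X ^ k) + homotopyAux k ∘ₗ mulX R M

/-- The contracting homotopy of `0 → R[X] ⊗ M → R[X] ⊗ M → M → 0`. -/
noncomputable def homotopy : R[X] ⊗[R] M →ₗ[R] R[X] ⊗[R] M :=
  TensorProduct.lift
    (Polynomial.lsum fun k => LinearMap.toSpanSingleton R _ (homotopyAux R M k))

theorem homotopy_X_pow_tmul (k : ℕ) (m : M) :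
    homotopy R M ((X ^ k) ⊗ₜ m) = homotopyAux R M k m := by
  simp [homotopy, ← monomial_one_right_eq_X_pow, Polynomial.lsum_apply]

/-- The sum telescopes, as in dividing `x ^ k - y ^ k` by `x - y`. -/
theorem tensorSub_homotopyAux (k : ℕ) (m : M) :
    tensorSub R M (homotopyAux R M k m) = (X ^ k) ⊗ₜ m - 1 ⊗ₜ ((X ^ k : R[X]) • m) := by
  induction k generalizing m with
  | zero => simp [homotopyAux]
  | succ k ih => simp [homotopyAux, ih, ← pow_succ, ← mul_smul]

theorem homotopy_tensorSub (t : R[X] ⊗[R] M) : homotopy R M (tensorSub R M t) = t := by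
  have : homotopy R M ∘ₗ (tensorSub R M).restrictScalars R = LinearMap.id := by
    refine TensorProduct.ext (Polynomial.lhom_ext' fun k => LinearMap.ext_ring ?_)
    ext m
    suffices homotopy R M ((X ^ k * X) ⊗ₜ m) - homotopy R M ((X ^ k) ⊗ₜ ((X : R[X]) • m)) =
        (X ^ k) ⊗ₜ m by simpa [monomial_one_right_eq_X_pow] using this
    rw [← pow_succ, homotopy_X_pow_tmul, homotopy_X_pow_tmul]
    simp [homotopyAux]
  exact LinearMap.congr_fun this t

theorem tensorSub_homotopy (t : R[X] ⊗[R] M) :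
    tensorSub R M (homotopy R M t) = t - 1 ⊗ₜ tensorAct R M t := by
  have : (tensorSub R M).restrictScalars R ∘ₗ homotopy R M =
      LinearMap.id - TensorProduct.mk R R[X] M 1 ∘ₗ (tensorAct R M).restrictScalars R := by
    refine TensorProduct.ext (Polynomial.lhom_ext' fun k => LinearMap.ext_ring ?_)
    ext m
    simp [monomial_one_right_eq_X_pow, homotopy_X_pow_tmul, tensorSub_homotopyAux]
  exact LinearMap.congr_fun this t

theorem exact_tensorSub_tensorAct : Function.Exact (tensorSub R M) (tensorAct R M) := by
  intro t
  constructor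
  · intro h
    exact ⟨homotopy R M t, by rw [tensorSub_homotopy, h, TensorProduct.tmul_zero, sub_zero]⟩
  · rintro ⟨s, rfl⟩
    induction s with
    | zero => simp
    | add x y hx hy => rw [map_add, map_add, hx, hy, add_zero]
    | tmul p m => simp [mul_smul]

end Polynomial

/-- In `0 → R[X] ⊗ M → R[X] ⊗ M → M → 0` the first two terms have dimension at most `d` by flat base
change. -/
theorem GlobalDimensionLE.polynomial {d : ℕ} (h : GlobalDimensionLE R d) :
    GlobalDimensionLE R[X] (d + 1) := by
  intro M
  let : Module R M := Module.compHom M (algebraMap R R[X])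
  have : IsScalarTower R R[X] M :=
    ⟨fun r s x => by
      rw [Algebra.smul_def, mul_smul]
      rfl⟩
  have hex := Polynomial.exact_tensorSub_tensorAct R M
  have hT := ModuleCat.shortComplex_shortExact
    (ModuleCat.shortComplexOfCompEqZero (Polynomial.tensorSub R M) (Polynomial.tensorAct R M)
      hex.linearMap_comp_eq_zero) hex
    (Function.LeftInverse.injective (Polynomial.homotopy_tensorSub R M))
    (fun m => ⟨1 ⊗ₜ m, by simp⟩)
  have := h (ModuleCat.of R M)
  have := ModuleCat.hasProjectiveDimensionLE_baseChange R[X] d (ModuleCat.of R M)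
  exact hT.hasProjectiveDimensionLT_X₃ (d + 1) this
    (hasProjectiveDimensionLT_of_ge _ (d + 1) (d + 2) (Nat.le_succ _))

theorem GlobalDimensionLE.mvPolynomial {d : ℕ} (h : GlobalDimensionLE R d) (m : ℕ) :
    GlobalDimensionLE (MvPolynomial (Fin m) R) (d + m) := by
  induction m with
  | zero => exact h.of_ringEquiv (MvPolynomial.isEmptyRingEquiv R (Fin 0)).symm
  | succ m ih => exact ih.polynomial.of_ringEquiv (MvPolynomial.finSuccEquiv R m).symm.toRingEquiv

end Polynomial

theorem isGorensteinRing_of_ringEquiv_mvPolynomial_int {S : Type u} [CommRing S] {m : ℕ}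
    (e : S ≃+* MvPolynomial (Fin m) ℤ) : IsGorensteinRing S := by
  -- `GlobalDimensionLE` is tied to the universe of the ring, so `ℤ` is lifted to that of `S`.
  have : IsPrincipalIdealRing (ULift.{u} ℤ) :=
    IsPrincipalIdealRing.of_surjective (ULift.ringEquiv (R := ℤ)).symm
      (ULift.ringEquiv (R := ℤ)).symm.surjective
  have : IsDomain (ULift.{u} ℤ) := (ULift.ringEquiv (R := ℤ)).isDomain
  have hS : GlobalDimensionLE S (1 + m) :=
    ((GlobalDimensionLE.of_isPrincipalIdealRing (ULift.{u} ℤ)).mvPolynomial m).of_ringEquiv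
      ((MvPolynomial.mapEquiv (Fin m) ULift.ringEquiv).trans e.symm)
  exact ⟨isNoetherianRing_of_ringEquiv _ e.symm,
    fun p _ => ⟨1 + m, (hS.localization p.primeCompl).hasInjectiveDimensionLE _⟩⟩

end GlobalDimension

/-! ### Injectivity from leading monomials -/

namespace MvPolynomial

variable {σ τ R : Type*} [CommRing R]

/-- The monomial `m` occurs in `p`, and all other monomials of `p` have smaller weight. -/
def LeadsWith (w : (τ →₀ ℕ) →+ ℕ) (p : MvPolynomial τ R) (m : τ →₀ ℕ) : Prop :=
  coeff m p ≠ 0 ∧ ∀ d, coeff d p ≠ 0 → d = m ∨ w d < w m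

variable {w : (τ →₀ ℕ) →+ ℕ}

theorem leadsWith_monomial (m : τ →₀ ℕ) {c : R} (hc : c ≠ 0) :
    LeadsWith w (monomial m c) m := by
  classical
  refine ⟨by simpa using hc, fun d hd => ?_⟩
  rw [coeff_monomial] at hd
  left
  by_contra h
  exact hd (if_neg (Ne.symm h))

theorem LeadsWith.mul [NoZeroDivisors R] {p q : MvPolynomial τ R} {m k : τ →₀ ℕ}
    (hp : LeadsWith w p m) (hq : LeadsWith w q k) : LeadsWith w (p * q) (m + k) := by
  classical
  constructor
  · rw [coeff_mul, Finset.sum_eq_single (m, k)]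
    · exact mul_ne_zero hp.1 hq.1
    · rintro ⟨x, y⟩ hxy hne
      rw [Finset.HasAntidiagonal.mem_antidiagonal] at hxy
      by_contra h0
      have hw := congrArg w hxy
      simp only [map_add] at hw
      rcases hp.2 x (left_ne_zero_of_mul h0) with rfl | h1
      · exact hne (Prod.ext rfl (add_left_cancel hxy))
      · rcases hq.2 y (right_ne_zero_of_mul h0) with rfl | h2 <;> omega
    · simp
  · intro d hd
    rw [coeff_mul] at hd
    obtain ⟨⟨x, y⟩, hxy, h0⟩ := Finset.exists_ne_zero_of_sum_ne_zero hd
    rw [Finset.HasAntidiagonal.mem_antidiagonal] at hxy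
    dsimp only at hxy h0
    subst hxy
    simp only [map_add]
    rcases hp.2 x (left_ne_zero_of_mul h0) with rfl | h1 <;>
      rcases hq.2 y (right_ne_zero_of_mul h0) with rfl | h2
    · exact Or.inl rfl
    all_goals right; omega

theorem LeadsWith.aeval_monomial [IsDomain R] {g : σ → MvPolynomial τ R}
    {e : (σ →₀ ℕ) →+ (τ →₀ ℕ)} (h : ∀ s, LeadsWith w (g s) (e (Finsupp.single s 1)))
    (m : σ →₀ ℕ) : LeadsWith w (aeval g (monomial m (1 : R))) (e m) := by
  have hone : LeadsWith w (1 : MvPolynomial τ R) 0 := leadsWith_monomial 0 one_ne_zero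
  induction m using Finsupp.induction_linear with
  | zero => simpa using hone
  | add a b ha hb =>
    rw [map_add, ← one_mul (1 : R), ← monomial_mul, map_mul]
    exact ha.mul hb
  | single s k =>
    induction k with
    | zero => simpa using hone
    | succ k ih =>
      rw [Finsupp.single_add, map_add, ← one_mul (1 : R), ← monomial_mul, map_mul]
      refine ih.mul ?_
      change LeadsWith w (aeval g (X s)) _
      rw [aeval_X]
      exact h s

/-- A homomorphism of polynomial rings is injective on the span of a set of monomials that have
distinct leading monomials. -/
theorem eq_zero_of_aeval_eq_zero [IsDomain R] {g : σ → MvPolynomial τ R}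
    {e : (σ →₀ ℕ) →+ (τ →₀ ℕ)} (h : ∀ s, LeadsWith w (g s) (e (Finsupp.single s 1)))
    {S : Set (σ →₀ ℕ)} (he : S.InjOn e) {p : MvPolynomial σ R} (hp : (p.support : Set _) ⊆ S)
    (h0 : aeval g p = 0) : p = 0 := by
  by_contra hne
  -- With `w (e m)` maximal, no other monomial of `p` contributes at `e m`: equality `e k = e m` is
  -- excluded by injectivity, a larger weight by maximality.
  obtain ⟨m, hm, hmax⟩ := p.support.exists_max_image (fun m => w (e m))
    (support_nonempty.2 hne)
  have hc : coeff (e m) (aeval g p) = coeff m p * coeff (e m) (aeval g (monomial m (1 : R))) := by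
    conv_lhs => rw [p.as_sum, map_sum, coeff_sum]
    have hsmul (k : σ →₀ ℕ) : aeval g (monomial k (coeff k p)) =
        coeff k p • aeval g (monomial k (1 : R)) := by
      rw [← map_smul, smul_monomial, smul_eq_mul, mul_one]
    simp only [hsmul, coeff_smul, smul_eq_mul]
    refine Finset.sum_eq_single m (fun k hk hkm => ?_) (fun h => absurd hm h)
    by_contra hk0
    rcases (LeadsWith.aeval_monomial h k).2 _ (right_ne_zero_of_mul hk0) with h1 | h1
    · exact hkm (he (hp hk) (hp hm) h1.symm)
    · exact (hmax k hk).not_gt h1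
  rw [h0, coeff_zero] at hc
  exact mul_ne_zero (mem_support_iff.1 hm) (LeadsWith.aeval_monomial h m).1 hc.symm

end MvPolynomial

/-! ### The kernel of `toChart` -/

namespace TypeIII

open MvPolynomial

variable {n : ℕ}

/-- The polynomial ring `ℤ[a_ij, z₁, T_j]`, `1 ≤ i ≤ n`, `2 ≤ j ≤ n + 1`. The variable `inr 0`
is `z₁`, and `inr k.succ` is `T_{k+2}`. -/
abbrev Chart (n : ℕ) : Type := MvPolynomial ((Fin n × Fin n) ⊕ Fin (n + 1)) ℤ

/-- The images of the variables under `toChart`. -/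
noncomputable def chartVar : (Fin n × Fin (n + 1)) ⊕ Fin (n + 1) → Chart n :=
  Sum.elim
    (fun ij => Fin.cases (-∑ k, X (Sum.inl (ij.1, k)) * X (Sum.inr k.succ))
      (fun k => X (Sum.inl (ij.1, k))) ij.2)
    (Fin.cases (X (Sum.inr 0)) (fun k => X (Sum.inr 0) * X (Sum.inr k.succ)))

/-- The homomorphism `ℤ[a_ij, z_j] → ℤ[a_ij, z₁, T_j]` that sends `z_j` to `z₁ T_j` and solves
`f_i(1, T) = 0` for `a_i1`. -/
noncomputable def toChart (n : ℕ) : Amb n →ₐ[ℤ] Chart n := aeval chartVar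

@[simp]
theorem toChart_a_zero (i : Fin n) :
    toChart n (a i 0) = -∑ k, X (Sum.inl (i, k)) * X (Sum.inr k.succ) := by
  simp [toChart, a, chartVar]

@[simp]
theorem toChart_a_succ (i k : Fin n) : toChart n (a i k.succ) = X (Sum.inl (i, k)) := by
  simp [toChart, a, chartVar]

@[simp]
theorem toChart_z_zero : toChart n (z 0) = X (Sum.inr 0) := by
  simp [toChart, z, chartVar]

@[simp]
theorem toChart_z_succ (k : Fin n) :
    toChart n (z k.succ) = X (Sum.inr 0) * X (Sum.inr k.succ) := by
  simp [toChart, z, chartVar]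

theorem toChart_f (i : Fin n) : toChart n (f i) = 0 := by
  simp only [f, Fin.sum_univ_succ, map_add, map_sum, map_mul, toChart_a_zero, toChart_a_succ,
    toChart_z_zero, toChart_z_succ, neg_mul, Finset.sum_mul]
  rw [neg_add_eq_zero]
  exact Finset.sum_congr rfl fun k _ => by ring

theorem IX_le_ker_toChart : IX n ≤ RingHom.ker (toChart n) := by
  rw [IX, Ideal.span_le]
  rintro _ ⟨i, rfl⟩
  exact toChart_f i

/-- The exponent of the leading monomial of the image of a monomial under `toChart`. -/
noncomputable def leadExp (n : ℕ) : ((Fin n × Fin (n + 1)) ⊕ Fin (n + 1) →₀ ℕ) →+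
    ((Fin n × Fin n) ⊕ Fin (n + 1) →₀ ℕ) where
  toFun m := Finsupp.equivFunOnFinite.symm (Sum.elim
    (fun ik => m (Sum.inl (ik.1, ik.2.succ)) + if ik.1 = ik.2 then m (Sum.inl (ik.1, 0)) else 0)
    (Fin.cases (∑ j, m (Sum.inr j)) (fun k => m (Sum.inl (k, 0)) + m (Sum.inr k.succ))))
  map_zero' := by
    ext (x | x)
    · simp
    · cases x using Fin.cases <;> simp
  map_add' m k := by
    ext (x | x)
    · simp only [Finsupp.equivFunOnFinite_symm_apply_apply, Sum.elim_inl, Finsupp.add_apply]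
      split_ifs <;> ring
    · cases x using Fin.cases
      · simp [Finset.sum_add_distrib]
      · simp only [Finsupp.equivFunOnFinite_symm_apply_apply, Sum.elim_inr, Finsupp.add_apply,
          Fin.cases_succ]
        ring

theorem leadExp_inl (m : (Fin n × Fin (n + 1)) ⊕ Fin (n + 1) →₀ ℕ) (i k : Fin n) :
    leadExp n m (Sum.inl (i, k)) =
      m (Sum.inl (i, k.succ)) + if i = k then m (Sum.inl (i, 0)) else 0 := rfl

theorem leadExp_inr_zero (m : (Fin n × Fin (n + 1)) ⊕ Fin (n + 1) →₀ ℕ) :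
    leadExp n m (Sum.inr 0) = ∑ j, m (Sum.inr j) := rfl

theorem leadExp_inr_succ (m : (Fin n × Fin (n + 1)) ⊕ Fin (n + 1) →₀ ℕ) (k : Fin n) :
    leadExp n m (Sum.inr k.succ) = m (Sum.inl (k, 0)) + m (Sum.inr k.succ) := rfl

/-- The weight on the monomials of `Chart n` for which the diagonal variables `a_{i,i+1}` have
weight one and the others weight zero. -/
noncomputable def diagWeight (n : ℕ) : ((Fin n × Fin n) ⊕ Fin (n + 1) →₀ ℕ) →+ ℕ :=
  Finsupp.weight (Sum.elim (fun ik => if ik.1 = ik.2 then 1 else 0) 0)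

/-- Only `a_{i1}` has a non-monomial image, `-∑ a_{i,k+1} T_{k+1}`; the weight singles out its
diagonal term `k = i`. -/
theorem leadsWith_chartVar (s : (Fin n × Fin (n + 1)) ⊕ Fin (n + 1)) :
    LeadsWith (diagWeight n) (chartVar s) (leadExp n (Finsupp.single s 1)) := by
  classical
  rcases s with ⟨i, j⟩ | j
  · cases j using Fin.cases with
    | zero =>
      have hexp : leadExp n (Finsupp.single (Sum.inl (i, 0)) 1) =
          Finsupp.single (Sum.inl (i, i)) 1 + Finsupp.single (Sum.inr i.succ) 1 := by
        ext (⟨x, y⟩ | x)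
        · simp only [leadExp_inl, Finsupp.single_apply, Finsupp.add_apply]
          simp [(Fin.succ_ne_zero _).symm]
          grind
        · cases x using Fin.cases
          · simp [leadExp_inr_zero]
          · simp [leadExp_inr_succ, Finsupp.single_apply]
      have hvar : chartVar (Sum.inl (i, 0)) = -∑ k, monomial (Finsupp.single (Sum.inl (i, k)) 1 +
          Finsupp.single (Sum.inr k.succ) 1 : (Fin n × Fin n) ⊕ Fin (n + 1) →₀ ℕ) (1 : ℤ) := by
        simp only [chartVar, Sum.elim_inl, Fin.cases_zero, X, monomial_mul, mul_one]
      have hinj (k l : Fin n) (h : (Finsupp.single (Sum.inl (i, k)) 1 +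
          Finsupp.single (Sum.inr k.succ) 1 : (Fin n × Fin n) ⊕ Fin (n + 1) →₀ ℕ) =
          Finsupp.single (Sum.inl (i, l)) 1 + Finsupp.single (Sum.inr l.succ) 1) : k = l := by
        have := DFunLike.congr_fun h (Sum.inr k.succ)
        by_contra hkl
        simp [Ne.symm hkl] at this
      rw [hexp, hvar]
      constructor
      · rw [coeff_neg, coeff_sum, Finset.sum_eq_single i]
        · simp
        · intro k _ hk
          rw [coeff_monomial, if_neg fun h => hk (hinj _ _ h)]
        · simp
      · intro d hd
        rw [coeff_neg, neg_ne_zero, coeff_sum] at hd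
        obtain ⟨k, -, hk⟩ := Finset.exists_ne_zero_of_sum_ne_zero hd
        rw [coeff_monomial] at hk
        have hdk := of_not_not fun h => hk (if_neg h)
        subst hdk
        by_cases hik : i = k
        · subst hik
          exact Or.inl rfl
        · right
          simp [diagWeight, Finsupp.weight_single, hik]
    | succ k =>
      have hexp : leadExp n (Finsupp.single (Sum.inl (i, k.succ)) 1) =
          Finsupp.single (Sum.inl (i, k)) 1 := by
        ext (⟨x, y⟩ | x)
        · simp [leadExp_inl, Finsupp.single_apply]
        · cases x using Fin.cases
          · simp [leadExp_inr_zero]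
          · simp [leadExp_inr_succ]
      rw [hexp]
      exact leadsWith_monomial _ one_ne_zero
  · cases j using Fin.cases with
    | zero =>
      have hexp : leadExp n (Finsupp.single (Sum.inr 0) 1) = Finsupp.single (Sum.inr 0) 1 := by
        ext (⟨x, y⟩ | x)
        · simp [leadExp_inl]
        · cases x using Fin.cases
          · simp [leadExp_inr_zero, Finsupp.single_apply]
          · simp [leadExp_inr_succ]
      rw [hexp]
      exact leadsWith_monomial _ one_ne_zero
    | succ k =>
      have hexp : leadExp n (Finsupp.single (Sum.inr k.succ) 1) =
          Finsupp.single (Sum.inr 0) 1 + Finsupp.single (Sum.inr k.succ) 1 := by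
        ext (⟨x, y⟩ | x)
        · simp [leadExp_inl]
        · cases x using Fin.cases
          · simp [leadExp_inr_zero, Finsupp.single_apply]
          · simp [leadExp_inr_succ, Finsupp.single_apply]
      rw [hexp]
      exact (leadsWith_monomial _ one_ne_zero).mul (leadsWith_monomial _ one_ne_zero)

/-- The exponents of the monomials that are divisible by no `a_{i,i+1} z_{i+1}`. -/
def reducedExp (n : ℕ) : Set ((Fin n × Fin (n + 1)) ⊕ Fin (n + 1) →₀ ℕ) :=
  {m | ∀ i : Fin n, m (Sum.inl (i, i.succ)) = 0 ∨ m (Sum.inr i.succ) = 0}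

/-- The exponent of `a_{i1}` is the minimum of the image exponents at `a_{i,i+1}` and `T_{i+1}`,
since one of the other two summands is zero. The remaining exponents follow by subtraction. -/
theorem injOn_leadExp : (reducedExp n).InjOn (leadExp n) := by
  intro m hm k hk h
  have h1 (i j : Fin n) := DFunLike.congr_fun h (Sum.inl (i, j))
  have h2 (i : Fin n) := DFunLike.congr_fun h (Sum.inr i.succ)
  have h3 := DFunLike.congr_fun h (Sum.inr 0)
  simp only [leadExp_inl, leadExp_inr_succ, leadExp_inr_zero, Fin.sum_univ_succ] at h1 h2 h3
  have hdiag (i : Fin n) : m (Sum.inl (i, 0)) = k (Sum.inl (i, 0)) ∧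
      m (Sum.inr i.succ) = k (Sum.inr i.succ) := by
    have := h1 i i
    have := h2 i
    have := hm i
    have := hk i
    grind
  ext (⟨i, j⟩ | j)
  · cases j using Fin.cases with
    | zero => exact (hdiag i).1
    | succ j =>
      have := h1 i j
      rw [(hdiag i).1] at this
      exact add_right_cancel this
  · cases j using Fin.cases with
    | zero =>
      rw [Finset.sum_congr rfl fun i _ => (hdiag i).2] at h3
      exact add_right_cancel h3
    | succ j => exact (hdiag j).2

/-- Rewriting `a_{i,i+1} z_{i+1}` by `f_i` lowers the total degree in the diagonal variables, so it
terminates. -/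
theorem monomial_mem_IX_sup (m : (Fin n × Fin (n + 1)) ⊕ Fin (n + 1) →₀ ℕ) :
    (monomial m 1 : Amb n) ∈
      (IX n).restrictScalars ℤ ⊔ restrictSupport ℤ (reducedExp n) := by
  induction hN : ∑ i : Fin n, m (Sum.inl (i, i.succ)) using Nat.strong_induction_on
    generalizing m with
  | _ N ih =>
    by_cases hm : m ∈ reducedExp n
    · refine Submodule.mem_sup_right ?_
      rw [mem_restrictSupport_iff]
      intro x hx
      rwa [Finset.mem_singleton.1 (support_monomial_subset hx)]
    · simp only [reducedExp, Set.mem_ofPred_eq, not_forall, not_or] at hm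
      obtain ⟨i, hi1, hi2⟩ := hm
      let v (j : Fin (n + 1)) : (Fin n × Fin (n + 1)) ⊕ Fin (n + 1) →₀ ℕ :=
        Finsupp.single (Sum.inl (i, j)) 1 + Finsupp.single (Sum.inr j) 1
      have hle : v i.succ ≤ m := by
        intro x
        simp only [v, Finsupp.add_apply, Finsupp.single_apply]
        rcases x with x | x
        · by_cases hx : (i, i.succ) = x
          · subst hx; simp; omega
          · simp [hx]
        · by_cases hx : i.succ = x
          · subst hx; simp; omega
          · simp [hx]
      obtain ⟨b, rfl⟩ := exists_add_of_le hle
      have hav (j : Fin (n + 1)) : (a i j * z j * monomial b 1 : Amb n) = monomial (v j + b) 1 := by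
        simp [a, z, X, v, monomial_mul]
      have hf : (monomial (v i.succ + b) 1 : Amb n) = f i * monomial b 1 -
          ∑ j ∈ Finset.univ.erase i.succ, monomial (v j + b) 1 := by
        rw [eq_sub_iff_add_eq,
          Finset.add_sum_erase _ (fun j => (monomial (v j + b) 1 : Amb n)) (Finset.mem_univ _), f,
          Finset.sum_mul]
        exact Finset.sum_congr rfl fun j _ => (hav j).symm
      rw [hf]
      refine Submodule.sub_mem _ (Submodule.mem_sup_left ?_)
        (Submodule.sum_mem _ fun j hj => ih _ ?_ _ rfl)
      · exact Ideal.mul_mem_right _ _ (Ideal.subset_span ⟨i, rfl⟩)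
      · rw [← hN]
        refine Finset.sum_lt_sum (fun k _ => ?_) ⟨i, Finset.mem_univ _, ?_⟩
        · have := (Finset.mem_erase.1 hj).1
          simp only [v, Finsupp.add_apply, Finsupp.single_apply]
          grind
        · have := (Finset.mem_erase.1 hj).1
          simp only [v, Finsupp.add_apply, Finsupp.single_apply]
          grind

theorem ker_toChart : RingHom.ker (toChart n) = IX n := by
  refine le_antisymm (fun p hp => ?_) IX_le_ker_toChart
  have hsup : p ∈ (IX n).restrictScalars ℤ ⊔ restrictSupport ℤ (reducedExp n) := by
    rw [p.as_sum]
    refine Submodule.sum_mem _ fun m _ => ?_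
    rw [← mul_one (coeff m p), ← smul_eq_mul, ← smul_monomial]
    exact Submodule.smul_mem _ _ (monomial_mem_IX_sup m)
  obtain ⟨q, hq, r, hr, rfl⟩ := Submodule.mem_sup.1 hsup
  have hr0 : toChart n r = 0 := by
    have := IX_le_ker_toChart hq
    rw [RingHom.mem_ker] at hp this
    rwa [map_add, this, zero_add] at hp
  rw [eq_zero_of_aeval_eq_zero leadsWith_chartVar injOn_leadExp
    ((mem_restrictSupport_iff _).1 hr) hr0, add_zero]
  exact hq

end TypeIII

/-! ### Elements of the residual ideal -/

/-- If `z` divides `δ y` for all `y ∈ I`, then `δ` is the value at `z` of the homomorphism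
`y ↦ δ y / z`. -/
theorem mem_residualIdeal_of_dvd {R : Type*} [CommRing R] [IsDomain R] {I : Ideal R} {z : I}
    (hz : (z : R) ≠ 0) {δ : R} (h : ∀ y ∈ I, (z : R) ∣ δ * y) : δ ∈ residualIdeal I z := by
  let g : I →ₗ[R] Submodule.span R {(z : R)} :=
    LinearMap.codRestrict _ ((LinearMap.lsmul R R δ).comp I.subtype)
      fun y => Ideal.mem_span_singleton.2 (h y y.2)
  let e := LinearEquiv.toSpanNonzeroSingleton R R (z : R) hz
  refine ⟨e.symm.toLinearMap.comp g, ?_⟩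
  change e.symm (g z) = δ
  rw [LinearEquiv.symm_apply_eq]
  rfl

namespace TypeIII

open MvPolynomial

variable {n : ℕ}

/-- The embedding of `O_X` in `ℤ[a_ij, z₁, T_j]`. -/
noncomputable def OXToChart (n : ℕ) : OX n →+* Chart n :=
  Ideal.Quotient.lift (IX n) (toChart n : Amb n →+* Chart n) fun _ h => IX_le_ker_toChart h

@[simp]
theorem OXToChart_mk (p : Amb n) : OXToChart n (Ideal.Quotient.mk (IX n) p) = toChart n p := rfl

theorem OXToChart_injective : Function.Injective (OXToChart n) := by
  rw [injective_iff_map_eq_zero]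
  intro x hx
  obtain ⟨p, rfl⟩ := Ideal.Quotient.mk_surjective x
  rw [Ideal.Quotient.eq_zero_iff_mem, ← ker_toChart]
  exact hx

instance isDomain_OX : IsDomain (OX n) := OXToChart_injective.isDomain

theorem zX_zero_ne_zero : (zX 0 : OX n) ≠ 0 := by
  intro h
  have := congrArg (OXToChart n) h
  rw [zX, OXToChart_mk, toChart_z_zero, map_zero] at this
  exact X_ne_zero _ this

/-- The class of `a_ij` in `O_X`. -/
noncomputable def aX (i : Fin n) (j : Fin (n + 1)) : OX n := Ideal.Quotient.mk (IX n) (a i j)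

theorem sum_aX_mul_zX (i : Fin n) : ∑ j, aX i j * zX j = (0 : OX n) := by
  have : Ideal.Quotient.mk (IX n) (f i) = 0 :=
    Ideal.Quotient.eq_zero_iff_mem.2 (Ideal.subset_span ⟨i, rfl⟩)
  simpa [f, aX, zX] using this

/-- The determinant of the matrix `(a_ij)`, `j ≥ 2`, in `O_X`. -/
noncomputable def detX (n : ℕ) : OX n := (Matrix.of fun i k : Fin n => aX i k.succ).det

/-- Cramer's rule: apply the adjugate to `A (z₂, …, z_{n+1}) = -z₁ (a_{i1})_i`. -/
theorem zX_zero_dvd_detX_mul (k : Fin n) : (zX 0 : OX n) ∣ detX n * zX k.succ := by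
  set A : Matrix (Fin n) (Fin n) (OX n) := Matrix.of fun i k => aX i k.succ with hA
  have h1 : A.mulVec (fun k => zX k.succ) = (zX 0 : OX n) • fun i => -aX i 0 := by
    ext i
    have := sum_aX_mul_zX i
    rw [Fin.sum_univ_succ, add_comm, add_eq_zero_iff_eq_neg] at this
    simp [Matrix.mulVec, dotProduct, hA, this, mul_comm (zX 0)]
    exact (neg_mul (aX i 0) (zX 0)).symm
  have h2 := congrArg A.adjugate.mulVec h1
  rw [Matrix.mulVec_mulVec, Matrix.adjugate_mul, Matrix.mulVec_smul, Matrix.smul_mulVec,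
    Matrix.one_mulVec] at h2
  exact ⟨_, congrFun h2 k⟩

theorem detX_mem_Ir : detX n ∈ Ir n := by
  refine mem_residualIdeal_of_dvd zX_zero_ne_zero fun y hy => ?_
  induction hy using Submodule.span_induction with
  | mem x hx =>
    obtain ⟨j, rfl⟩ := hx
    cases j using Fin.cases with
    | zero => exact dvd_mul_left _ _
    | succ k => exact zX_zero_dvd_detX_mul k
  | zero => simp
  | add x y _ _ hx hy =>
    rw [mul_add]
    exact dvd_add hx hy
  | smul c x _ hx =>
    rw [smul_eq_mul, mul_left_comm]
    exact hx.mul_left c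

theorem zX_zero_mem_Ir : zX 0 ∈ Ir n := ⟨(ID n).subtype, rfl⟩

/-- The homomorphism `O_X → ℤ[a_ij]` that sends each `z_j` to zero. -/
noncomputable def zeroSection (n : ℕ) : OX n →+* MvPolynomial (Fin n × Fin (n + 1)) ℤ :=
  Ideal.Quotient.lift (IX n)
    (aeval (R := ℤ) (Sum.elim X 0) : Amb n →ₐ[ℤ] MvPolynomial (Fin n × Fin (n + 1)) ℤ).toRingHom
    fun p hp => by
      have h : IX n ≤ RingHom.ker (aeval (R := ℤ) (Sum.elim X 0) :
          Amb n →ₐ[ℤ] MvPolynomial (Fin n × Fin (n + 1)) ℤ).toRingHom := by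
        rw [IX, Ideal.span_le]
        rintro _ ⟨i, rfl⟩
        simp [f, z, a, RingHom.mem_ker]
      exact h hp

@[simp]
theorem zeroSection_aX (i : Fin n) (j : Fin (n + 1)) : zeroSection n (aX i j) = X (i, j) := by
  simp [zeroSection, aX, a]

@[simp]
theorem zeroSection_zX (j : Fin (n + 1)) : zeroSection n (zX j) = 0 := by
  simp [zeroSection, zX, z]

/-- Modulo `I_D`, `zeroSection` followed by the inclusion of `ℤ[a_ij]` is the identity. -/
theorem mem_ID_of_zeroSection_eq_zero {x : OX n} (hx : zeroSection n x = 0) : x ∈ ID n := by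
  obtain ⟨p, rfl⟩ := Ideal.Quotient.mk_surjective x
  have h : ((Ideal.Quotient.mk (ID n)).comp (Ideal.Quotient.mk (IX n))) =
      (((Ideal.Quotient.mk (ID n)).comp (Ideal.Quotient.mk (IX n))).comp
        (rename (R := ℤ) Sum.inl).toRingHom).comp
        ((zeroSection n).comp (Ideal.Quotient.mk (IX n))) := by
    refine ringHom_ext (fun r => by simp) ?_
    rintro (⟨i, j⟩ | j)
    · change Ideal.Quotient.mk (ID n) (aX i j) = Ideal.Quotient.mk (ID n)
        (Ideal.Quotient.mk (IX n) (rename Sum.inl (zeroSection n (aX i j))))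
      rw [zeroSection_aX, rename_X]
      rfl
    · change Ideal.Quotient.mk (ID n) (zX j) = Ideal.Quotient.mk (ID n)
        (Ideal.Quotient.mk (IX n) (rename Sum.inl (zeroSection n (zX j))))
      rw [zeroSection_zX, map_zero, map_zero, map_zero]
      exact Ideal.Quotient.eq_zero_iff_mem.2 (Ideal.subset_span ⟨j, rfl⟩)
  have := RingHom.congr_fun h p
  rw [RingHom.comp_apply _ ((zeroSection n).comp _), RingHom.comp_apply (zeroSection n), hx,
    map_zero] at this
  exact Ideal.Quotient.eq_zero_iff_mem.1 this

theorem zeroSection_detX_ne_zero : zeroSection n (detX n) ≠ 0 := by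
  intro h
  -- Specialize the matrix to the identity.
  have h1 := congrArg (aeval (R := ℤ) fun ij : Fin n × Fin (n + 1) =>
    if ij.2 = ij.1.succ then (1 : ℤ) else 0) h
  rw [detX, RingHom.map_det, AlgHom.map_det, map_zero] at h1
  refine one_ne_zero (α := ℤ) ?_
  rw [← h1, ← Matrix.det_one (n := Fin n)]
  congr 1
  ext i k
  simp [Matrix.one_apply, eq_comm]

/-- The colon ideal `(z₁ : det)` of `O_X` is contained in `I_D`. -/
theorem mem_ID_of_mul_detX {u v : OX n} (h : u * detX n = v * zX 0) : u ∈ ID n := by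
  refine mem_ID_of_zeroSection_eq_zero ?_
  have := congrArg (zeroSection n) h
  rw [map_mul, map_mul, zeroSection_zX, mul_zero] at this
  exact (mul_eq_zero.1 this).resolve_right zeroSection_detX_ne_zero

/-! ### Presentation of the chart ring -/

/-- The homomorphism `ℤ[a_ij, z_j][T] → ℤ[a_ij, z₁, T_j]` that extends `toChart`. -/
noncomputable def polyToChart (n : ℕ) : MvPolynomial (Fin n) (Amb n) →+* Chart n :=
  eval₂Hom (toChart n : Amb n →+* Chart n) fun k => X (Sum.inr k.succ)

@[simp]
theorem polyToChart_C (p : Amb n) : polyToChart n (C p) = toChart n p := by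
  simp [polyToChart]

@[simp]
theorem polyToChart_X (k : Fin n) : polyToChart n (X k) = X (Sum.inr k.succ) := by
  simp [polyToChart]

/-- The section of `polyToChart` that maps variables to variables. -/
noncomputable def chartToPoly (n : ℕ) : Chart n →ₐ[ℤ] MvPolynomial (Fin n) (Amb n) :=
  aeval (Sum.elim (fun ik => C (a ik.1 ik.2.succ)) (Fin.cases (C (z 0)) X))

@[simp]
theorem chartToPoly_inl (i k : Fin n) :
    chartToPoly n (X (Sum.inl (i, k))) = C (a i k.succ) := by
  simp [chartToPoly]

@[simp]
theorem chartToPoly_inr_zero : chartToPoly n (X (Sum.inr 0)) = C (z 0) := by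
  simp [chartToPoly]

@[simp]
theorem chartToPoly_inr_succ (k : Fin n) : chartToPoly n (X (Sum.inr k.succ)) = X k := by
  simp [chartToPoly]

theorem polyToChart_chartToPoly (p : Chart n) : polyToChart n (chartToPoly n p) = p := by
  have : (polyToChart n).comp (chartToPoly n : Chart n →+* _) = RingHom.id _ := by
    refine ringHom_ext (fun r => by simp) ?_
    rintro (⟨i, k⟩ | j)
    · simp
    · cases j using Fin.cases <;> simp
  exact RingHom.congr_fun this p

theorem formOne_eq (j : Fin n) :
    formOne j = C (a j 0) + ∑ k : Fin n, C (a j k.succ) * X k := by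
  simp [formOne, form, Fin.sum_univ_succ, algebraMap_eq]

/-- Modulo the relations, `chartToPoly` inverts `polyToChart`: only `a_{i1}` and `z_k`, `k ≥ 2`,
move, each by a generator up to sign. -/
theorem ker_polyToChart : RingHom.ker (polyToChart n) = relations n := by
  refine le_antisymm (fun p hp => ?_) ?_
  · have h : Ideal.Quotient.mk (relations n) =
        ((Ideal.Quotient.mk (relations n)).comp (chartToPoly n : Chart n →+* _)).comp
          (polyToChart n) := by
      refine ringHom_ext (fun r => ?_) fun k => by simp
      have : (Ideal.Quotient.mk (relations n)).comp C =
          (((Ideal.Quotient.mk (relations n)).comp (chartToPoly n : Chart n →+* _)).comp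
            (polyToChart n)).comp C := by
        refine ringHom_ext (fun r => by simp) ?_
        rintro (⟨i, j⟩ | j)
        · change Ideal.Quotient.mk (relations n) (C (a i j)) =
            Ideal.Quotient.mk (relations n) (chartToPoly n (polyToChart n (C (a i j))))
          cases j using Fin.cases with
          | zero =>
            rw [Ideal.Quotient.eq]
            refine Ideal.subset_span (Or.inr ⟨i, ?_⟩)
            simp [formOne_eq]
          | succ k => simp
        · change Ideal.Quotient.mk (relations n) (C (z j)) =
            Ideal.Quotient.mk (relations n) (chartToPoly n (polyToChart n (C (z j))))
          cases j using Fin.cases with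
          | zero => simp
          | succ k =>
            rw [Ideal.Quotient.eq]
            refine Ideal.subset_span (Or.inl ⟨k, ?_⟩)
            simp
      exact RingHom.congr_fun this r
    have := RingHom.congr_fun h p
    rw [RingHom.comp_apply _ (polyToChart n), hp, map_zero] at this
    exact Ideal.Quotient.eq_zero_iff_mem.1 this
  · rw [relations, Ideal.span_le]
    rintro _ (⟨k, rfl⟩ | ⟨j, rfl⟩)
    · simp [RingHom.mem_ker]
    · simp [RingHom.mem_ker, formOne_eq]

/-! ### Kernel and image of `φ` in the quotient field -/

section FractionField

variable (K : Type u) [Field K] [Algebra (OX n) K]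

/-- The homomorphism `ℤ[a_ij, z₁, T_j] → K` that sends `T_j` to `z_j / z₁`. -/
noncomputable def chartToField (n : ℕ) (K : Type u) [Field K] [Algebra (OX n) K] :
    Chart n →+* K :=
  eval₂Hom (Int.castRingHom K) (Sum.elim (fun ik => algebraMap (OX n) K (aX ik.1 ik.2.succ))
    (Fin.cases (algebraMap (OX n) K (zX 0))
      fun k => algebraMap (OX n) K (zX k.succ) / algebraMap (OX n) K (zX 0)))

theorem φ_C (p : Amb n) : φ n K (C p) = algebraMap (OX n) K (Ideal.Quotient.mk (IX n) p) := by
  simp [φ]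

theorem φ_X (k : Fin n) :
    φ n K (X k) = algebraMap (OX n) K (zX k.succ) / algebraMap (OX n) K (zX 0) := by
  simp [φ]

variable [IsFractionRing (OX n) K]

theorem algebraMap_zX_zero_ne_zero : algebraMap (OX n) K (zX 0) ≠ 0 := by
  rw [Ne, FaithfulSMul.algebraMap_eq_zero_iff]
  exact zX_zero_ne_zero

theorem chartToField_comp_polyToChart : (chartToField n K).comp (polyToChart n) = φ n K := by
  have hz := algebraMap_zX_zero_ne_zero (n := n) K
  refine ringHom_ext (fun r => ?_) fun k => by simp [chartToField, φ]
  have : ((chartToField n K).comp (polyToChart n)).comp C = (φ n K).comp C := by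
    refine ringHom_ext (fun r => by simp) ?_
    rintro (⟨i, j⟩ | j)
    · change chartToField n K (polyToChart n (C (a i j))) = φ n K (C (a i j))
      rw [φ_C, polyToChart_C]
      change _ = algebraMap (OX n) K (aX i j)
      cases j using Fin.cases with
      | zero =>
        have h := congrArg (algebraMap (OX n) K) (sum_aX_mul_zX i)
        rw [Fin.sum_univ_succ, map_add, map_mul, map_sum, map_zero] at h
        rw [← mul_left_inj' hz, eq_neg_of_add_eq_zero_left h]
        simp only [toChart_a_zero, map_neg, map_sum, map_mul, neg_mul, Finset.sum_mul]
        congr 1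
        refine Finset.sum_congr rfl fun k _ => ?_
        simp [chartToField, mul_assoc, div_mul_cancel₀ _ hz]
      | succ k => simp [chartToField]
    · change chartToField n K (polyToChart n (C (z j))) = φ n K (C (z j))
      rw [φ_C, polyToChart_C]
      change _ = algebraMap (OX n) K (zX j)
      cases j using Fin.cases with
      | zero => simp [chartToField]
      | succ k => simp [chartToField, mul_div_cancel₀ _ hz]
  exact RingHom.congr_fun this r

/-- The embedding of `O_X` extends to `θ : K → Frac (Chart n)`, and `θ` after `chartToField` is the
canonical inclusion. -/
theorem chartToField_injective : Function.Injective (chartToField n K) := by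
  let L := FractionRing (Chart n)
  have hinj : Function.Injective ((algebraMap (Chart n) L).comp (OXToChart n)) :=
    (IsFractionRing.injective (Chart n) L).comp OXToChart_injective
  let θ : K →+* L := IsFractionRing.lift hinj
  have hθ (x : OX n) : θ (algebraMap (OX n) K x) = algebraMap (Chart n) L (OXToChart n x) :=
    IsFractionRing.lift_algebraMap hinj x
  have hX : algebraMap (Chart n) L (X (Sum.inr 0)) ≠ 0 := by
    rw [Ne, FaithfulSMul.algebraMap_eq_zero_iff]
    exact X_ne_zero _
  have hcomp : θ.comp (chartToField n K) = algebraMap (Chart n) L := by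
    refine ringHom_ext (fun r => by simp) ?_
    rintro (⟨i, k⟩ | j)
    · simp [chartToField, hθ, aX]
    · cases j using Fin.cases with
      | zero => simp [chartToField, hθ, zX]
      | succ k => simp [chartToField, hθ, zX, mul_div_cancel_left₀ _ hX]
  refine Function.Injective.of_comp (f := θ) ?_
  rw [← RingHom.coe_comp, hcomp]
  exact IsFractionRing.injective (Chart n) L

theorem ker_φ : RingHom.ker (φ n K) = relations n := by
  rw [← chartToField_comp_polyToChart, ← ker_polyToChart]
  exact RingHom.ker_comp_of_injective _ (chartToField_injective K)

theorem range_φ_eq_range_chartToField : (φ n K).range = (chartToField n K).range := by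
  rw [← chartToField_comp_polyToChart]
  ext x
  constructor
  · rintro ⟨p, rfl⟩
    exact ⟨polyToChart n p, rfl⟩
  · rintro ⟨p, rfl⟩
    exact ⟨chartToPoly n p, by rw [RingHom.comp_apply, polyToChart_chartToPoly]⟩

theorem div_mem_inverseSet (k : Fin n) :
    algebraMap (OX n) K (zX k.succ) / algebraMap (OX n) K (zX 0) ∈ inverseSet K (Ir n) := by
  have hz := algebraMap_zX_zero_ne_zero (n := n) K
  rintro _ ⟨h, rfl⟩
  let y (j : Fin (n + 1)) : ID n := ⟨zX j, Ideal.subset_span ⟨j, rfl⟩⟩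
  have hy : zX k.succ * h (y 0) = zX 0 * h (y k.succ) := by
    rw [← smul_eq_mul, ← smul_eq_mul, ← map_smul, ← map_smul]
    congr 1
    exact Subtype.ext (mul_comm _ _)
  refine ⟨h (y k.succ), ?_⟩
  rw [div_mul_eq_mul_div, eq_div_iff hz, ← map_mul, mul_comm, ← hy, map_mul]
  rfl

theorem inverseSet_subset_range_φ : inverseSet K (Ir n) ⊆ (φ n K).range := by
  have hz := algebraMap_zX_zero_ne_zero (n := n) K
  intro x hx
  obtain ⟨u, hu⟩ := hx _ zX_zero_mem_Ir
  obtain ⟨v, hv⟩ := hx _ detX_mem_Ir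
  have huv : u * detX n = v * zX 0 := by
    apply IsFractionRing.injective (OX n) K
    rw [map_mul, map_mul, hu, hv]
    ring
  -- Here `u = x z₁ = ∑ c_j z_j`; dividing by `z₁` expresses `x` through the `z_k / z₁`.
  obtain ⟨c, hc⟩ := (Ideal.mem_span_range_iff_exists_fun).1 (mem_ID_of_mul_detX huv)
  have hOX (y : OX n) : algebraMap (OX n) K y ∈ (φ n K).range := by
    obtain ⟨p, rfl⟩ := Ideal.Quotient.mk_surjective y
    exact ⟨C p, φ_C K p⟩
  have hx' : x = algebraMap (OX n) K (c 0) + ∑ k : Fin n, algebraMap (OX n) K (c k.succ) *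
      φ n K (X k) := by
    rw [← mul_left_inj' hz, ← hu, ← hc, Fin.sum_univ_succ, add_mul, Finset.sum_mul, map_add,
      map_sum, map_mul]
    congr 1
    refine Finset.sum_congr rfl fun k _ => ?_
    rw [φ_X, map_mul, mul_assoc, div_mul_cancel₀ _ hz]
  rw [hx']
  exact add_mem (hOX _) (sum_mem fun k _ => mul_mem (hOX _) ⟨_, rfl⟩)

theorem range_φ : (φ n K).range = (unprojection n K).toSubring := by
  apply le_antisymm
  · rintro _ ⟨p, rfl⟩
    change φ n K p ∈ unprojection n K
    induction p using MvPolynomial.induction_on with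
    | C p =>
      rw [φ_C]
      exact Subalgebra.algebraMap_mem _ _
    | add p q hp hq =>
      rw [map_add]
      exact add_mem hp hq
    | mul_X p k hp =>
      rw [map_mul, φ_X]
      exact mul_mem hp (Algebra.subset_adjoin (div_mem_inverseSet K k))
  · intro x hx
    change x ∈ Algebra.adjoin (OX n) (inverseSet K (Ir n)) at hx
    induction hx using Algebra.adjoin_induction with
    | mem x hx => exact inverseSet_subset_range_φ K hx
    | algebraMap y =>
      obtain ⟨p, rfl⟩ := Ideal.Quotient.mk_surjective y
      exact ⟨C p, φ_C K p⟩
    | add x y _ _ hx hy => exact add_mem hx hy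
    | mul x y _ _ hx hy => exact mul_mem hx hy

/-- The unprojection ring is a polynomial ring over `ℤ`. -/
theorem nonempty_unprojection_ringEquiv :
    Nonempty (unprojection n K ≃+* MvPolynomial (Fin (n ^ 2 + n + 1)) ℤ) := by
  have hrange : (chartToField n K).range = (unprojection n K).toSubring := by
    rw [← range_φ, range_φ_eq_range_chartToField]
  have hcard : Fintype.card ((Fin n × Fin n) ⊕ Fin (n + 1)) = n ^ 2 + n + 1 := by
    simp
    ring
  let e1 : Chart n ≃+* (chartToField n K).range :=
    RingEquiv.ofBijective (chartToField n K).rangeRestrict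
      ⟨fun x y h => chartToField_injective K (congrArg Subtype.val h),
        (chartToField n K).rangeRestrict_surjective⟩
  let e2 : (chartToField n K).range ≃+* (unprojection n K).toSubring :=
    RingEquiv.subringCongr hrange
  exact ⟨(e1.trans e2).symm.trans
    (renameEquiv ℤ (Fintype.equivFinOfCardEq hcard)).toRingEquiv⟩

end FractionField

end TypeIII

theorem mainTheorem1 (n : ℕ) (hn : 1 ≤ n) :
    IsDomain (TypeIII.OX n) ∧
    ∀ (K : Type u) [Field K] [Algebra (TypeIII.OX n) K] [IsFractionRing (TypeIII.OX n) K],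
      RingHom.ker (TypeIII.φ n K) = TypeIII.relations n ∧
      (TypeIII.φ n K).range = (TypeIII.unprojection n K).toSubring ∧
      Nonempty (TypeIII.unprojection n K ≃+* MvPolynomial (Fin (n ^ 2 + n + 1)) ℤ) ∧
      IsGorensteinRing (TypeIII.unprojection n K) := by
  refine ⟨inferInstance, fun K _ _ _ => ⟨TypeIII.ker_φ K, TypeIII.range_φ K,
    TypeIII.nonempty_unprojection_ringEquiv K, ?_⟩⟩
  obtain ⟨e⟩ := TypeIII.nonempty_unprojection_ringEquiv (n := n) K
  exact isGorensteinRing_of_ringEquiv_mvPolynomial_int e
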